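/- **Notation.** Let $(-1)^z=e^{\pi i z}$, let $\mathrm{Ei}(x)=\int_{-\infty}^{x}\frac{e^t}{t}\,dt$ for $x<0$, and let $\Gamma(a,x)=\int_x^\infty e^{-t}t^{a-1}\,dt$ for $a\in\mathbb C$, $x>0$ (the upper incomplete gamma function). *Alternating Kurepa's function* $A$ is defined by $$A(z)=\int_0^\infty e^{-t}\,\frac{t^{z+1}-(-1)^z t}{t+1}\,dt\qquad(\operatorname{Re} z>0)$$ and is continued to $\operatorname{Re} z\le 0$ by the relation $A(z)=\Gamma(z+2)-A(z+1)$; it is meromorphic on $\mathbb C$ with poles exactly at $z=-2,-3,\dots$. The function $A_1$ is defined for $z\in\mathbb C\setminus\mathbb Z$ by the absolutely convergent series $$A_1(z)=\sum_{n=0}^{\infty}(-1)^n\,\Gamma(z+1-n).$$ For a function $f$ meromorphic at $a$, its *principal value at the point* $a$ is $$\mathop{\mathrm{p.v.}}_{z=a} f(z)=\lim_{\rho\to0+}\frac1{2\pi i}\oint_{|z-a|=\rho}\frac{f(z)}{z-a}\,dz .$$ **Theorem.** 1. For every $z\in\mathbb C\setminus\{-2,-3,-4,\dots\}$, $$A(z)=-\bigl(1+e\,\mathrm{Ei}(-1)\bigr)(-1)^z+e\,\Gamma(z+2)\,\Gamma(-z-1,1).$$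 2. For every $z\in\mathbb C\setminus\mathbb Z$, $$A_1(z)=-\frac{\pi e}{\sin \pi z}+e\,\Gamma(z+2)\,\Gamma(-z-1,1).$$ 3. At every integer point $m\in\mathbb Z$ both formulas hold in the sense of the principal value at the point: $A$, $A_1$, $\frac{\pi e}{\sin\pi z}$ and $e\,\Gamma(z+2)\Gamma(-z-1,1)$ are meromorphic at $m$, the principal values below exist, and $$\mathop{\mathrm{p.v.}}_{z=m}A(z)=-\bigl(1+e\,\mathrm{Ei}(-1)\bigr)(-1)^m+\mathop{\mathrm{p.v.}}_{z=m}\bigl(e\,\Gamma(z+2)\,\Gamma(-z-1,1)\bigr),$$ $$\mathop{\mathrm{p.v.}}_{z=m}A_1(z)=\mathop{\mathrm{p.v.}}_{z=m}\Bigl(-\frac{\pi e}{\sin\pi z}\Bigr)+\mathop{\mathrm{p.v.}}_{z=m}\bigl(e\,\Gamma(z+2)\,\Gamma(-z-1,1)\bigr).$$ -/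

import Mathlib

open MeasureTheory Filter Topology Set

noncomputable section

namespace AltKurepa

/-- The integrand `e^{-t} (t^{z+1} - (-1)^z t) / (t+1)`, where `(-1)^z = exp (π i z)`. -/
def kurepaIntegrand (z : ℂ) (t : ℝ) : ℂ :=
  (Real.exp (-t) : ℂ) * (((t : ℂ) ^ (z + 1) - (-1 : ℂ) ^ z * (t : ℂ)) / ((t : ℂ) + 1))

/-- The integral `∫_0^∞ e^{-t} (t^{z+1} - (-1)^z t) / (t+1) dt`, used for `Re z > 0`. -/
def kurepaIntegral (z : ℂ) : ℂ :=
  ∫ t in Ioi (0 : ℝ), kurepaIntegrand z t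

/-- `n` steps of the continuation to the left by `A(z) = Γ(z+2) - A(z+1)`. -/
def kurepaStep : ℕ → ℂ → ℂ
  | 0, z => kurepaIntegral z
  | n + 1, z => Complex.Gamma (z + 2) - kurepaStep n (z + 1)

/-- Alternating Kurepa's function `A(z)`: the integral for `Re z > 0`, continued to `Re z ≤ 0` by
`A(z) = Γ(z+2) - A(z+1)`, see `A_of_re_pos` and `A_of_re_nonpos`. The number `⌊1 - Re z⌋₊` is the
least `n` with `Re (z + n) > 0`. The value at the poles `-2, -3, …` is irrelevant. -/
def A (z : ℂ) : ℂ :=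
  kurepaStep ⌊1 - z.re⌋₊ z

/-- The function `A₁(z) = ∑_{n ≥ 0} (-1)^n Γ(z+1-n)`, for `z` not an integer. -/
def A₁ (z : ℂ) : ℂ :=
  ∑' n : ℕ, (-1 : ℂ) ^ n * Complex.Gamma (z + 1 - n)

/-- The exponential integral `Ei(x) = ∫_{-∞}^x e^t / t dt`, for `x < 0`. -/
def Ei (x : ℝ) : ℝ :=
  ∫ t in Iic x, Real.exp t / t

/-- The upper incomplete gamma function `Γ(a,x) = ∫_x^∞ e^{-t} t^{a-1} dt`, for `x > 0`. -/
def upperGamma (a : ℂ) (x : ℝ) : ℂ :=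
  ∫ t in Ioi x, (Real.exp (-t) : ℂ) * (t : ℂ) ^ (a - 1)

/-- `f` is meromorphic at `a`, and its principal value at the point `a`,
`lim_{ρ → 0+} (1 / 2πi) ∮_{|z-a|=ρ} f(z) / (z-a) dz`, exists and equals `v`. -/
def HasPV (f : ℂ → ℂ) (a v : ℂ) : Prop :=
  MeromorphicAt f a ∧
    Tendsto (fun ρ : ℝ => (2 * (Real.pi : ℂ) * Complex.I)⁻¹ * ∮ z in C(a, ρ), f z / (z - a))
      (𝓝[>] 0) (𝓝 v)

theorem A_of_re_pos {z : ℂ} (hz : 0 < z.re) : A z = kurepaIntegral z := by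
  have h : ⌊1 - z.re⌋₊ = 0 := Nat.floor_eq_zero.2 (by linarith)
  simp [A, h, kurepaStep]

theorem A_of_re_nonpos {z : ℂ} (hz : z.re ≤ 0) : A z = Complex.Gamma (z + 2) - A (z + 1) := by
  have h : ⌊1 - z.re⌋₊ = ⌊1 - (z + 1).re⌋₊ + 1 := by
    rw [← Nat.floor_add_one (by simp; linarith)]
    congr 1
    simp
    ring
  rw [A, h, kurepaStep, A]

/-- The integral that defines `A` converges for `Re z > 0`. -/
theorem integrableOn_kurepaIntegrand {z : ℂ} (hz : 0 < z.re) :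
    IntegrableOn (kurepaIntegrand z) (Ioi 0) := by
  have h1 : IntegrableOn (fun t : ℝ => (Real.exp (-t) : ℂ) * (t : ℂ) ^ (z + 2 - 1)) (Ioi 0) := by
    simpa using Complex.GammaIntegral_convergent (s := z + 2) (by simp; linarith)
  have h2 : IntegrableOn (fun t : ℝ => (Real.exp (-t) : ℂ) * (t : ℂ) ^ ((2 : ℂ) - 1)) (Ioi 0) := by
    simpa using Complex.GammaIntegral_convergent (s := 2) (by simp)
  have h3 := h1.sub (h2.const_mul ((-1 : ℂ) ^ z))
  have h4 : IntegrableOn (fun t : ℝ => ((t : ℂ) + 1)⁻¹ *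
      ((Real.exp (-t) : ℂ) * (t : ℂ) ^ (z + 2 - 1) -
        (-1 : ℂ) ^ z * ((Real.exp (-t) : ℂ) * (t : ℂ) ^ ((2 : ℂ) - 1)))) (Ioi 0) := by
    refine Integrable.bdd_mul (c := 1) h3 ?_ ?_
    · exact (by fun_prop : Measurable fun t : ℝ => ((t : ℂ) + 1)⁻¹).aestronglyMeasurable
    · filter_upwards [ae_restrict_mem measurableSet_Ioi] with t ht
      have ht' : (0 : ℝ) < t := ht
      have : ((t : ℂ) + 1) = ((t + 1 : ℝ) : ℂ) := by push_cast; rfl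
      rw [this, norm_inv, Complex.norm_real, Real.norm_of_nonneg (by linarith)]
      exact inv_le_one_of_one_le₀ (by linarith)
  refine h4.congr_fun (fun t _ => ?_) measurableSet_Ioi
  have e1 : z + 2 - 1 = z + 1 := by ring
  have e2 : (2 : ℂ) - 1 = 1 := by norm_num
  simp only [kurepaIntegrand, e1, e2, Complex.cpow_one]
  ring

/-- The integral that defines `Ei x` converges for `x < 0`. -/
theorem integrableOn_Ei {x : ℝ} (hx : x < 0) :
    IntegrableOn (fun t : ℝ => Real.exp t / t) (Iic x) := by
  have h : IntegrableOn (fun t : ℝ => t⁻¹ * Real.exp t) (Iic x) := by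
    refine Integrable.bdd_mul (c := |x|⁻¹) (integrableOn_exp_Iic x) ?_ ?_
    · exact measurable_inv.aestronglyMeasurable
    · filter_upwards [ae_restrict_mem measurableSet_Iic] with t ht
      have ht' : t ≤ x := ht
      rw [norm_inv, Real.norm_eq_abs]
      refine inv_anti₀ (abs_pos.2 hx.ne) ?_
      rw [abs_of_neg hx, abs_of_neg (by linarith)]
      linarith
  refine h.congr_fun (fun t _ => ?_) measurableSet_Iic
  simp only [div_eq_mul_inv, mul_comm]

/-- The integral that defines `upperGamma a x` converges for `x > 0` and every complex `a`. -/
theorem integrableOn_upperGamma (a : ℂ) {x : ℝ} (hx : 0 < x) :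
    IntegrableOn (fun t : ℝ => (Real.exp (-t) : ℂ) * (t : ℂ) ^ (a - 1)) (Ioi x) := by
  have hr : IntegrableOn (fun t : ℝ => Real.exp (-t) * t ^ (a.re - 1)) (Ioi x) := by
    refine integrable_of_isBigO_exp_neg (b := 1 / 2) (by norm_num) (fun t ht => ?_)
      (Real.Gamma_integrand_isLittleO _).isBigO
    have ht' : 0 < t := lt_of_lt_of_le hx ht
    refine ContinuousAt.continuousWithinAt (ContinuousAt.mul (by fun_prop) ?_)
    exact Real.continuousAt_rpow_const t _ (Or.inl ht'.ne')
  refine Integrable.mono' hr ?_ ?_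
  · refine ContinuousOn.aestronglyMeasurable (fun t ht => ?_) measurableSet_Ioi
    have ht' : 0 < t := lt_trans hx ht
    refine ContinuousAt.continuousWithinAt (ContinuousAt.mul (by fun_prop) ?_)
    exact Complex.continuousAt_ofReal_cpow_const t (a - 1) (Or.inr ht'.ne')
  · filter_upwards [ae_restrict_mem measurableSet_Ioi] with t ht
    have ht' : 0 < t := lt_trans hx ht
    rw [norm_mul, Complex.norm_real, Real.norm_of_nonneg (Real.exp_pos _).le,
      Complex.norm_cpow_eq_rpow_re_of_pos ht']
    simp

/-- The series that defines `A₁ z` converges absolutely if `z` is not an integer. -/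
theorem summable_A₁ {z : ℂ} (hz : ∀ m : ℤ, z ≠ m) :
    Summable fun n : ℕ => ‖(-1 : ℂ) ^ n * Complex.Gamma (z + 1 - n)‖ := by
  have hG : ∀ n : ℕ, Complex.Gamma (z + 1 - n) ≠ 0 := fun n => by
    refine Complex.Gamma_ne_zero fun k hk => hz (n - 1 - k) ?_
    push_cast
    linear_combination hk
  have hr : ∀ n : ℕ, Complex.Gamma (z + 1 - n) = (z - n) * Complex.Gamma (z + 1 - (n + 1 : ℕ)) := by
    intro n
    have h0 : z - n ≠ 0 := fun h => hz n (by push_cast; linear_combination h)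
    rw [show z + 1 - ((n + 1 : ℕ) : ℂ) = z - n by push_cast; ring, ← Complex.Gamma_add_one _ h0]
    congr 1
    ring
  refine summable_of_ratio_test_tendsto_lt_one (l := 0) one_pos
    (Eventually.of_forall fun n => by simpa using hG n) ?_
  have ht : Tendsto (fun n : ℕ => ‖z - n‖⁻¹) atTop (𝓝 0) := by
    refine tendsto_inv_atTop_zero.comp (tendsto_atTop_mono (f := fun n : ℕ => (n : ℝ) - ‖z‖) ?_ ?_)
    · intro n
      have := norm_sub_norm_le (n : ℂ) z
      rwa [Complex.norm_natCast, norm_sub_rev] at this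
    · exact tendsto_atTop_add_const_right _ _ tendsto_natCast_atTop_atTop
  refine ht.congr fun n => ?_
  have h1 : ‖Complex.Gamma (z + 1 - (n + 1 : ℕ))‖ ≠ 0 := norm_ne_zero_iff.2 (hG _)
  simp only [norm_mul, norm_pow, norm_neg, norm_one, one_pow, one_mul, norm_norm]
  rw [hr n, norm_mul, mul_comm ‖z - n‖, div_mul_cancel_left₀ h1]

end AltKurepa

end

open MeasureTheory Filter Topology Set

namespace AltKurepa

/-! ### The upper incomplete gamma function -/

/-! Write G(z) = e Γ(z+2) Γ(-z-1,1). Since e^{-t}/(t+1) = e ∫_1^∞ e^{-v(t+1)} dv, Fubini gives ∫_0^∞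
e^{-t} t^{z+1}/(t+1) dt = G(z) for Re z > -2. As t/(t+1) = 1 - 1/(t+1) and G(-1) = -e Ei(-1), this
evaluates A for Re z > 0. The recurrence of the incomplete gamma function gives G(z) + G(z+1) =
Γ(z+2), while (-1)^z changes sign under z ↦ z+1, so the closed form obeys the relation that
continues A.

For A₁, the same recurrence unrolls the closed form to the left into a partial sum of the series
plus a remainder. By the reflection formula the remainder is, up to sign, e Γ(z-N+2) times a lower
incomplete gamma value; the latter is eventually bounded by 1 and the former is a term of a
convergent series.

Principal values exist for meromorphic functions, are additive, and ignore the value at the point,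
so both identities pass to the integers. -/

theorem upperGamma_eq_mellin (a : ℂ) :
    upperGamma a 1 = mellin ((Ioi (1 : ℝ)).indicator fun t => (Real.exp (-t) : ℂ)) a := by
  have h : ∀ t : ℝ, (t : ℂ) ^ (a - 1) • (Ioi (1 : ℝ)).indicator (fun t => (Real.exp (-t) : ℂ)) t =
      (Ioi (1 : ℝ)).indicator (fun t : ℝ => (Real.exp (-t) : ℂ) * (t : ℂ) ^ (a - 1)) t := by
    intro t
    by_cases ht : t ∈ Ioi (1 : ℝ)
    · rw [indicator_of_mem ht, indicator_of_mem ht, smul_eq_mul, mul_comm]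
    · rw [indicator_of_notMem ht, indicator_of_notMem ht, smul_zero]
  rw [mellin, upperGamma]
  simp_rw [h]
  rw [setIntegral_indicator measurableSet_Ioi,
    inter_eq_self_of_subset_right (Ioi_subset_Ioi zero_le_one)]

/-- The truncated exponential vanishes near 0 and decays faster than any power at infinity, so its
Mellin transform is entire. -/
theorem differentiable_upperGamma : Differentiable ℂ fun a => upperGamma a 1 := by
  intro a
  have hfun : (fun a => upperGamma a 1) =
      mellin ((Ioi (1 : ℝ)).indicator fun t => (Real.exp (-t) : ℂ)) :=
    funext upperGamma_eq_mellin
  rw [hfun]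
  have hcont : Continuous fun t : ℝ => (Real.exp (-t) : ℂ) := by fun_prop
  refine mellin_differentiableAt_of_isBigO_rpow (a := a.re + 1) (b := a.re - 1) ?_ ?_
    (by linarith) ?_ (by linarith)
  · exact (hcont.locallyIntegrable.indicator measurableSet_Ioi).locallyIntegrableOn _
  · have h1 : (fun t : ℝ => Real.exp (-t)) =O[atTop] fun t : ℝ => t ^ (-(a.re + 1)) := by
      simpa using (isLittleO_exp_neg_mul_rpow_atTop one_pos (-(a.re + 1))).isBigO
    refine (Asymptotics.IsBigO.of_norm_left ?_).trans h1
    refine Asymptotics.IsBigO.of_bound 1 (Eventually.of_forall fun t => ?_)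
    rw [norm_norm, one_mul]
    refine (norm_indicator_le_norm_self _ _).trans ?_
    rw [Complex.norm_real]
  · refine (Asymptotics.isBigO_zero _ _).congr' ?_ EventuallyEq.rfl
    filter_upwards [mem_nhdsWithin_of_mem_nhds (Iio_mem_nhds zero_lt_one)] with t ht
    exact (indicator_of_notMem (fun h : 1 < t => lt_asymm h ht) _).symm

/-- Integration by parts: integrate the derivative of e^{-t} t^a over (1, ∞). -/
theorem upperGamma_add_one (a : ℂ) :
    upperGamma (a + 1) 1 = a * upperGamma a 1 + (Real.exp (-1) : ℂ) := by
  have hi1 := integrableOn_upperGamma (a + 1) one_pos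
  have hi0 := integrableOn_upperGamma a one_pos
  have hd : ∀ t ∈ Ici (1 : ℝ), HasDerivAt (fun t : ℝ => (Real.exp (-t) : ℂ) * (t : ℂ) ^ a)
      (a * ((Real.exp (-t) : ℂ) * (t : ℂ) ^ (a - 1)) -
        (Real.exp (-t) : ℂ) * (t : ℂ) ^ (a + 1 - 1)) t := by
    intro t ht
    have ht' : (0 : ℝ) < t := lt_of_lt_of_le one_pos ht
    have h1 : HasDerivAt (fun t : ℝ => (Real.exp (-t) : ℂ)) ((-Real.exp (-t) : ℝ) : ℂ) t := by
      simpa using ((Real.hasDerivAt_exp (-t)).comp t (hasDerivAt_neg t)).ofReal_comp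
    have h2 : HasDerivAt (fun t : ℝ => (t : ℂ) ^ a) (a * (t : ℂ) ^ (a - 1)) t := by
      have hid : HasDerivAt (fun w : ℂ => w ^ a) (a * (t : ℂ) ^ (a - 1)) (t : ℂ) := by
        simpa using (hasDerivAt_id (t : ℂ)).cpow_const (c := a)
          (Or.inl (by simpa using ht'))
      exact hid.comp_ofReal
    refine (h1.mul h2).congr_deriv ?_
    rw [add_sub_cancel_right]
    push_cast
    ring
  have hlim : Tendsto (fun t : ℝ => (Real.exp (-t) : ℂ) * (t : ℂ) ^ a) atTop (𝓝 0) := by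
    rw [tendsto_zero_iff_norm_tendsto_zero]
    refine (tendsto_rpow_mul_exp_neg_mul_atTop_nhds_zero a.re 1 one_pos).congr' ?_
    filter_upwards [eventually_gt_atTop 0] with t ht
    rw [norm_mul, Complex.norm_real, Real.norm_of_nonneg (Real.exp_pos _).le,
      Complex.norm_cpow_eq_rpow_re_of_pos ht, neg_one_mul, mul_comm]
  have key := integral_Ioi_of_hasDerivAt_of_tendsto' hd ((hi0.const_mul a).sub hi1) hlim
  rw [integral_sub (hi0.const_mul a) hi1, integral_const_mul] at key
  simp only [Complex.ofReal_one, Complex.one_cpow, mul_one] at key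
  simp only [upperGamma]
  linear_combination -key

/-- The difference is the integral over (0, 1], where the integrand has norm at most 1. -/
theorem norm_Gamma_sub_upperGamma_le {a : ℂ} (ha : 1 ≤ a.re) :
    ‖Complex.Gamma a - upperGamma a 1‖ ≤ 1 := by
  have hi := Complex.GammaIntegral_convergent (s := a) (by linarith)
  have hsplit := setIntegral_union (μ := volume)
    (f := fun t : ℝ => (Real.exp (-t) : ℂ) * (t : ℂ) ^ (a - 1))
    (Ioc_disjoint_Ioi_same (a := (0 : ℝ)) (b := 1)) measurableSet_Ioi
    (hi.mono_set Ioc_subset_Ioi_self) (hi.mono_set (Ioi_subset_Ioi zero_le_one))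
  rw [Ioc_union_Ioi_eq_Ioi zero_le_one] at hsplit
  rw [Complex.Gamma_eq_integral (by linarith), Complex.GammaIntegral, hsplit, upperGamma,
    add_sub_cancel_right]
  refine (norm_setIntegral_le_of_norm_le_const (C := 1) (by simp) fun t ht => ?_).trans
    (by simp)
  rw [norm_mul, Complex.norm_real, Real.norm_of_nonneg (Real.exp_pos _).le,
    Complex.norm_cpow_eq_rpow_re_of_pos ht.1]
  refine mul_le_one₀ (Real.exp_le_one_iff.2 (by linarith [ht.1])) (by have := ht.1; positivity) ?_
  exact Real.rpow_le_one ht.1.le ht.2 (by simpa using ha)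

theorem Ei_neg_one : (Ei (-1) : ℂ) = -upperGamma 0 1 := by
  have h : Ei (-1) = -∫ t in Ioi (1 : ℝ), Real.exp (-t) / t := by
    rw [Ei, ← integral_neg, ← neg_neg (1 : ℝ), ← integral_comp_neg_Iic]
    simp [div_neg]
  rw [h, upperGamma, Complex.ofReal_neg, ← integral_complex_ofReal]
  congr 1
  refine setIntegral_congr_fun measurableSet_Ioi fun t _ => ?_
  simp [Complex.cpow_neg_one, div_eq_mul_inv]

/-! ### The function `e Γ(z+2) Γ(-z-1,1)` -/

/-- The function `e Γ(z+2) Γ(-z-1,1)`. -/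
noncomputable def gammaProduct (z : ℂ) : ℂ :=
  (Real.exp 1 : ℂ) * Complex.Gamma (z + 2) * upperGamma (-z - 1) 1

theorem exp_one_mul_exp_neg_one : (Real.exp 1 : ℂ) * (Real.exp (-1) : ℂ) = 1 := by
  rw [← Complex.ofReal_mul, ← Real.exp_add]
  simp

theorem gammaProduct_add_gammaProduct_add_one {z : ℂ} (hz : z + 2 ≠ 0) :
    gammaProduct z + gammaProduct (z + 1) = Complex.Gamma (z + 2) := by
  have h1 := upperGamma_add_one (-(z + 1) - 1)
  rw [show -(z + 1) - 1 + 1 = -z - 1 by ring] at h1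
  have h2 := Complex.Gamma_add_one _ hz
  rw [show z + 2 + 1 = z + 1 + 2 by ring] at h2
  rw [gammaProduct, gammaProduct, h1, h2]
  linear_combination Complex.Gamma (z + 2) * exp_one_mul_exp_neg_one

theorem integral_cpow_mul_exp_neg_mul_add_one {z : ℂ} (hz : -2 < z.re) {v : ℝ} (hv : 0 < v) :
    ∫ t in Ioi (0 : ℝ), (t : ℂ) ^ (z + 1) * (Real.exp (-(v * (t + 1))) : ℂ) =
      Complex.Gamma (z + 2) * ((Real.exp (-v) : ℂ) * (v : ℂ) ^ (-z - 1 - 1)) := by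
  have h := Complex.integral_cpow_mul_exp_neg_mul_Ioi (a := z + 2) (r := v)
    (by simp; linarith) (by simpa using hv)
  have h' : ∀ t : ℝ, (t : ℂ) ^ (z + 1) * (Real.exp (-(v * (t + 1))) : ℂ) =
      (Real.exp (-v) : ℂ) * ((t : ℂ) ^ (z + 2 - 1) * Complex.exp (-(v * t))) := by
    intro t
    rw [show z + 2 - 1 = z + 1 by ring, show -(v * (t + 1)) = -v + -(v * t) by ring, Real.exp_add]
    push_cast
    ring
  simp_rw [h']
  rw [integral_const_mul, h, show -z - 1 - 1 = -(z + 2) by ring, Complex.cpow_neg, one_div,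
    Complex.inv_cpow _ _ (by rw [Complex.arg_ofReal_of_nonneg hv.le]; exact Real.pi_pos.ne)]
  ring

theorem integral_exp_neg_mul_Ioi_one {c : ℝ} (hc : 0 < c) :
    ∫ v in Ioi (1 : ℝ), Real.exp (-(v * c)) = Real.exp (-c) / c := by
  have h := integral_exp_mul_Ioi (a := -c) (by linarith) 1
  simp only [mul_one, neg_div_neg_eq] at h
  rw [← h]
  refine setIntegral_congr_fun measurableSet_Ioi fun v _ => ?_
  congr 1
  ring

theorem integrable_cpow_mul_exp_neg_mul_add_one {z : ℂ} (hz : -2 < z.re) :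
    Integrable (fun p : ℝ × ℝ => (p.1 : ℂ) ^ (z + 1) * (Real.exp (-(p.2 * (p.1 + 1))) : ℂ))
      ((volume.restrict (Ioi 0)).prod (volume.restrict (Ioi 1))) := by
  have h1 : IntegrableOn (fun t : ℝ => Real.exp (-t) * t ^ (z.re + 2 - 1)) (Ioi 0) :=
    Real.GammaIntegral_convergent (by linarith)
  have h2 : IntegrableOn (fun v : ℝ => Real.exp (-v)) (Ioi 1) := integrableOn_exp_neg_Ioi 1
  -- For t > 0 and v > 1, v(t+1) ≥ t + v, so a Gamma integrand in t times e^{-v} dominates.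
  refine (Integrable.mul_prod h1 h2).mono' ?_ ?_
  · refine Measurable.aestronglyMeasurable ?_
    fun_prop
  · rw [Measure.prod_restrict]
    filter_upwards [ae_restrict_mem (measurableSet_Ioi.prod measurableSet_Ioi)] with p hp
    have ht : 0 < p.1 := hp.1
    have hv : 1 < p.2 := hp.2
    rw [norm_mul, Complex.norm_real, Real.norm_of_nonneg (Real.exp_pos _).le,
      Complex.norm_cpow_eq_rpow_re_of_pos ht, mul_comm (Real.exp (-p.1)), mul_assoc,
      ← Real.exp_add, show (z + 1).re = z.re + 2 - 1 by simp; ring]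
    refine mul_le_mul_of_nonneg_left (Real.exp_le_exp.2 ?_) (by positivity)
    nlinarith

theorem integral_exp_neg_mul_cpow_div_add_one {z : ℂ} (hz : -2 < z.re) :
    ∫ t in Ioi (0 : ℝ), (Real.exp (-t) : ℂ) * ((t : ℂ) ^ (z + 1) / ((t : ℂ) + 1)) =
      gammaProduct z := by
  have hswap := integral_integral_swap
    (f := fun t v : ℝ => (t : ℂ) ^ (z + 1) * (Real.exp (-(v * (t + 1))) : ℂ))
    (integrable_cpow_mul_exp_neg_mul_add_one hz)
  have hR : ∫ v in Ioi (1 : ℝ), ∫ t in Ioi (0 : ℝ),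
      (t : ℂ) ^ (z + 1) * (Real.exp (-(v * (t + 1))) : ℂ) =
        Complex.Gamma (z + 2) * upperGamma (-z - 1) 1 := by
    rw [upperGamma, ← integral_const_mul]
    exact setIntegral_congr_fun measurableSet_Ioi fun v hv =>
      integral_cpow_mul_exp_neg_mul_add_one hz (one_pos.trans hv)
  rw [gammaProduct, mul_assoc, ← hR, ← hswap, ← integral_const_mul]
  refine setIntegral_congr_fun measurableSet_Ioi fun t ht => ?_
  have ht' : (0 : ℝ) < t + 1 := by linarith [mem_Ioi.1 ht]
  rw [integral_const_mul, integral_complex_ofReal, integral_exp_neg_mul_Ioi_one ht',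
    show -(t + 1) = -t + -1 by ring, Real.exp_add]
  simp only [Complex.ofReal_div, Complex.ofReal_mul, Complex.ofReal_add, Complex.ofReal_one]
  linear_combination (-((Real.exp (-t) : ℂ) * (t : ℂ) ^ (z + 1) / ((t : ℂ) + 1))) *
    exp_one_mul_exp_neg_one

/-! ### The closed form of `A` -/

theorem integrableOn_exp_neg_mul_cpow_div_add_one {z : ℂ} (hz : -2 < z.re) :
    IntegrableOn (fun t : ℝ => (Real.exp (-t) : ℂ) * ((t : ℂ) ^ (z + 1) / ((t : ℂ) + 1)))
      (Ioi 0) := by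
  have h1 : IntegrableOn (fun t : ℝ => (Real.exp (-t) : ℂ) * (t : ℂ) ^ (z + 2 - 1)) (Ioi 0) := by
    simpa using Complex.GammaIntegral_convergent (s := z + 2) (by simp; linarith)
  have h2 : IntegrableOn (fun t : ℝ => ((t : ℂ) + 1)⁻¹ *
      ((Real.exp (-t) : ℂ) * (t : ℂ) ^ (z + 2 - 1))) (Ioi 0) := by
    refine Integrable.bdd_mul (c := 1) h1 ?_ ?_
    · exact (by fun_prop : Measurable fun t : ℝ => ((t : ℂ) + 1)⁻¹).aestronglyMeasurable
    · filter_upwards [ae_restrict_mem measurableSet_Ioi] with t ht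
      have ht' : (0 : ℝ) < t := ht
      rw [show (t : ℂ) + 1 = ((t + 1 : ℝ) : ℂ) by push_cast; rfl, norm_inv, Complex.norm_real,
        Real.norm_of_nonneg (by linarith)]
      exact inv_le_one_of_one_le₀ (by linarith)
  refine h2.congr_fun (fun t _ => ?_) measurableSet_Ioi
  beta_reduce
  rw [show z + 2 - 1 = z + 1 by ring]
  ring

theorem gammaProduct_neg_one :
    gammaProduct (-1) = -((Real.exp 1 : ℂ) * (Ei (-1) : ℂ)) := by
  rw [gammaProduct, Ei_neg_one, show (-1 : ℂ) + 2 = 1 by norm_num, Complex.Gamma_one]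
  norm_num

/-- The closed form of `A`. -/
noncomputable def closedForm (z : ℂ) : ℂ :=
  -(1 + (Real.exp 1 : ℂ) * (Ei (-1) : ℂ)) * (-1 : ℂ) ^ z + gammaProduct z

theorem kurepaIntegral_eq_closedForm {z : ℂ} (hz : 0 < z.re) :
    kurepaIntegral z = closedForm z := by
  have h1 := integrableOn_exp_neg_mul_cpow_div_add_one (z := z) (by linarith)
  -- At z = -1 the power is t^0, which leaves e^{-t}/(t+1), the other half of t/(t+1) = 1 - 1/(t+1).
  have h2 := integrableOn_exp_neg_mul_cpow_div_add_one (z := -1) (by simp)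
  have h3 : IntegrableOn (fun t : ℝ => (Real.exp (-t) : ℂ)) (Ioi 0) :=
    (integrableOn_exp_neg_Ioi 0).ofReal
  have h32 : IntegrableOn (fun t : ℝ => (Real.exp (-t) : ℂ) -
      (Real.exp (-t) : ℂ) * ((t : ℂ) ^ ((-1 : ℂ) + 1) / ((t : ℂ) + 1))) (Ioi 0) := h3.sub h2
  have hpt : ∀ t ∈ Ioi (0 : ℝ), kurepaIntegrand z t =
      (Real.exp (-t) : ℂ) * ((t : ℂ) ^ (z + 1) / ((t : ℂ) + 1)) -
        (-1 : ℂ) ^ z * ((Real.exp (-t) : ℂ) -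
          (Real.exp (-t) : ℂ) * ((t : ℂ) ^ ((-1 : ℂ) + 1) / ((t : ℂ) + 1))) := by
    intro t ht
    have ht' : (t : ℂ) + 1 ≠ 0 := by
      have : t + 1 ≠ 0 := by linarith [mem_Ioi.1 ht]
      exact_mod_cast this
    rw [kurepaIntegrand, neg_add_cancel, Complex.cpow_zero]
    field_simp
    ring
  have h4 : ∫ t in Ioi (0 : ℝ), (Real.exp (-t) : ℂ) = 1 := by
    rw [integral_complex_ofReal, integral_exp_neg_Ioi_zero, Complex.ofReal_one]
  rw [kurepaIntegral, setIntegral_congr_fun measurableSet_Ioi hpt,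
    integral_sub h1 (h32.const_mul _), integral_const_mul, integral_sub h3 h2, h4,
    integral_exp_neg_mul_cpow_div_add_one (by linarith),
    integral_exp_neg_mul_cpow_div_add_one (by simp), gammaProduct_neg_one, closedForm]
  ring

theorem closedForm_eq_Gamma_sub {z : ℂ} (hz : z + 2 ≠ 0) :
    closedForm z = Complex.Gamma (z + 2) - closedForm (z + 1) := by
  rw [closedForm, closedForm, Complex.cpow_add _ _ (by norm_num), Complex.cpow_one,
    ← gammaProduct_add_gammaProduct_add_one hz]
  ring

/-- Each step needs only z ≠ -2, and the excluded set is such that z + 1 avoids it whenever z does.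
-/
theorem kurepaStep_eq_closedForm (n : ℕ) {z : ℂ} (hn : 0 < z.re + n)
    (hz : ∀ k : ℕ, 2 ≤ k → z ≠ -(k : ℂ)) : kurepaStep n z = closedForm z := by
  induction n generalizing z with
  | zero => exact kurepaIntegral_eq_closedForm (by simpa using hn)
  | succ n ih =>
    rw [kurepaStep, ih, ← closedForm_eq_Gamma_sub]
    · exact fun h => hz 2 le_rfl (by push_cast; linear_combination h)
    · push_cast at hn
      simp only [Complex.add_re, Complex.one_re]
      linarith
    · intro k hk h
      exact hz (k + 1) (by omega) (by push_cast; linear_combination h)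

theorem A_eq_closedForm {z : ℂ} (hz : ∀ k : ℕ, 2 ≤ k → z ≠ -(k : ℂ)) : A z = closedForm z :=
  kurepaStep_eq_closedForm _ (by linarith [Nat.lt_floor_add_one (1 - z.re)]) hz

/-! ### The closed form of `A₁` -/

/-- The closed form of `A₁`. -/
noncomputable def closedForm₁ (z : ℂ) : ℂ :=
  -((Real.pi : ℂ) * (Real.exp 1 : ℂ) / Complex.sin ((Real.pi : ℂ) * z)) + gammaProduct z

theorem closedForm₁_add_closedForm₁_sub_one {z : ℂ} (hz : z + 1 ≠ 0) :
    closedForm₁ z + closedForm₁ (z - 1) = Complex.Gamma (z + 1) := by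
  have h := gammaProduct_add_gammaProduct_add_one (z := z - 1)
    (by rwa [show z - 1 + 2 = z + 1 by ring])
  rw [show z - 1 + 2 = z + 1 by ring, sub_add_cancel] at h
  rw [closedForm₁, closedForm₁, ← h, mul_sub, mul_one, Complex.sin_sub_pi, div_neg]
  ring

/-- Reflection turns π / sin πz into Γ(z+2) Γ(-z-1), so the two terms merge into a lower incomplete
gamma function, which is easy to bound far to the left. -/
theorem closedForm₁_eq (z : ℂ) :
    closedForm₁ z = -((Real.exp 1 : ℂ) * Complex.Gamma (z + 2) *
      (Complex.Gamma (-z - 1) - upperGamma (-z - 1) 1)) := by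
  have h := Complex.Gamma_mul_Gamma_one_sub (z + 2)
  rw [show 1 - (z + 2) = -z - 1 by ring,
    show (Real.pi : ℂ) * (z + 2) = Real.pi * z + 2 * Real.pi by ring,
    Complex.sin_add_two_pi] at h
  rw [closedForm₁, gammaProduct, mul_comm (Real.pi : ℂ), mul_div_assoc, ← h]
  ring

theorem closedForm₁_eq_sum_add {z : ℂ} (hz : ∀ m : ℤ, z ≠ m) (N : ℕ) :
    closedForm₁ z = ∑ n ∈ Finset.range N, (-1 : ℂ) ^ n * Complex.Gamma (z + 1 - n) +
      (-1 : ℂ) ^ N * closedForm₁ (z - N) := by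
  induction N with
  | zero => simp
  | succ N ih =>
    have h := closedForm₁_add_closedForm₁_sub_one (z := z - N)
      (fun h => hz (N - 1) (by push_cast; linear_combination h))
    rw [ih, Finset.sum_range_succ, show z + 1 - (N : ℂ) = z - N + 1 by ring, ← h]
    push_cast
    rw [← sub_sub]
    ring

theorem A₁_eq_closedForm₁ {z : ℂ} (hz : ∀ m : ℤ, z ≠ m) : A₁ z = closedForm₁ z := by
  have hs := summable_A₁ hz
  have hG : Tendsto (fun N : ℕ => Real.exp 1 * ‖Complex.Gamma (z - 1 + 1 - N + 2)‖) atTop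
      (𝓝 (Real.exp 1 * 0)) := by
    refine Tendsto.const_mul _ ?_
    -- With N = n + 1 the argument becomes z + 1 - n, that of the n-th term of the series.
    rw [← tendsto_add_atTop_iff_nat 1]
    refine hs.tendsto_atTop_zero.congr fun n => ?_
    rw [norm_mul, norm_pow, norm_neg, norm_one, one_pow, one_mul]
    push_cast
    congr 2
    ring
  rw [mul_zero] at hG
  have hrem : Tendsto (fun N : ℕ => (-1 : ℂ) ^ N * closedForm₁ (z - N)) atTop (𝓝 0) := by
    refine squeeze_zero_norm' ?_ hG
    -- This makes Re(-(z-N)-1) = N - Re z - 1 at least 1, as the bound on the lower part requires.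
    obtain ⟨N₀, hN₀⟩ := exists_nat_ge (z.re + 2)
    filter_upwards [eventually_ge_atTop N₀] with N hN
    have hNr : (N₀ : ℝ) ≤ N := by exact_mod_cast hN
    rw [norm_mul, norm_pow, norm_neg, norm_one, one_pow, one_mul, closedForm₁_eq, norm_neg,
      norm_mul, norm_mul, Complex.norm_real, Real.norm_of_nonneg (Real.exp_pos _).le,
      show z - 1 + 1 - (N : ℂ) + 2 = z - N + 2 by ring]
    refine mul_le_of_le_one_right (by positivity) (norm_Gamma_sub_upperGamma_le ?_)
    simp only [Complex.sub_re, Complex.neg_re, Complex.natCast_re, Complex.one_re]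
    linarith
  have hsum := hs.of_norm.hasSum.tendsto_sum_nat
  refine tendsto_nhds_unique (hsum.add hrem |>.congr fun N => (closedForm₁_eq_sum_add hz N).symm)
    tendsto_const_nhds |> fun h => ?_
  rwa [add_zero] at h

/-! ### Principal values at a point -/

theorem eventually_circle_of_eventually_nhdsNE {a : ℂ} {p : ℂ → Prop} (h : ∀ᶠ z in 𝓝[≠] a, p z) :
    ∀ᶠ ρ : ℝ in 𝓝[>] 0, ∀ z ∈ Metric.closedBall a ρ \ {a}, p z := by
  rw [eventually_nhdsWithin_iff, Metric.eventually_nhds_iff] at h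
  obtain ⟨ε, hε, h⟩ := h
  filter_upwards [Ioo_mem_nhdsGT hε] with ρ hρ z hz
  exact h (lt_of_le_of_lt hz.1 hρ.2) hz.2

theorem sphere_subset_closedBall_sdiff_center {a : ℂ} {ρ : ℝ} (hρ : 0 < ρ) :
    Metric.sphere a ρ ⊆ Metric.closedBall a ρ \ {a} := fun _ hz =>
  ⟨Metric.sphere_subset_closedBall hz, Metric.ne_of_mem_sphere hz hρ.ne'⟩

theorem MeromorphicAt.div_sub_center {f : ℂ → ℂ} {a : ℂ} (hf : MeromorphicAt f a) :
    MeromorphicAt (fun z => f z / (z - a)) a :=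
  hf.div ((MeromorphicAt.id a).sub (MeromorphicAt.const a a))

/-- By Cauchy's theorem on annuli the circle integral does not depend on the radius once it is
small, so the limit is that of a constant. -/
theorem MeromorphicAt.exists_hasPV {f : ℂ → ℂ} {a : ℂ} (hf : MeromorphicAt f a) :
    ∃ v, HasPV f a v := by
  have hev := eventually_circle_of_eventually_nhdsNE
    (MeromorphicAt.div_sub_center hf).eventually_analyticAt
  obtain ⟨R, hR, hR0⟩ := (hev.and self_mem_nhdsWithin).exists
  have hR0 : 0 < R := hR0
  refine ⟨_, hf, tendsto_const_nhds.congr' (f₁ := fun _ =>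
    (2 * (Real.pi : ℂ) * Complex.I)⁻¹ * ∮ z in C(a, R), f z / (z - a)) ?_⟩
  filter_upwards [Ioo_mem_nhdsGT hR0] with ρ hρ
  congr 1
  have han : ∀ z ∈ Metric.closedBall a R \ Metric.ball a ρ,
      AnalyticAt ℂ (fun z => f z / (z - a)) z := fun z hz =>
    hR z ⟨hz.1, fun h => hz.2 (by rw [mem_singleton_iff.1 h]; exact Metric.mem_ball_self hρ.1)⟩
  refine Complex.circleIntegral_eq_of_differentiable_on_annulus_off_countable hρ.1 hρ.2.le
    countable_empty (fun z hz => (han z hz).continuousAt.continuousWithinAt) fun z hz => ?_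
  exact (han z ⟨Metric.ball_subset_closedBall hz.1.1,
    fun h => hz.1.2 (Metric.ball_subset_closedBall h)⟩).differentiableAt

theorem HasPV.congr {f g : ℂ → ℂ} {a v : ℂ} (hf : HasPV f a v) (h : f =ᶠ[𝓝[≠] a] g) :
    HasPV g a v := by
  refine ⟨hf.1.congr h, hf.2.congr' ?_⟩
  filter_upwards [eventually_circle_of_eventually_nhdsNE h, self_mem_nhdsWithin] with ρ hρ hρ0
  congr 1
  refine circleIntegral.integral_congr (le_of_lt hρ0) fun z hz => ?_
  rw [hρ z (sphere_subset_closedBall_sdiff_center hρ0 hz)]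

theorem MeromorphicAt.eventually_circleIntegrable {f : ℂ → ℂ} {a : ℂ} (hf : MeromorphicAt f a) :
    ∀ᶠ ρ : ℝ in 𝓝[>] 0, CircleIntegrable f a ρ := by
  filter_upwards [eventually_circle_of_eventually_nhdsNE hf.eventually_analyticAt,
    self_mem_nhdsWithin] with ρ hρ hρ0
  refine ContinuousOn.circleIntegrable (le_of_lt hρ0) fun z hz => ?_
  exact (hρ z (sphere_subset_closedBall_sdiff_center hρ0 hz)).continuousAt.continuousWithinAt

theorem HasPV.add {f g : ℂ → ℂ} {a v w : ℂ} (hf : HasPV f a v) (hg : HasPV g a w) :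
    HasPV (fun z => f z + g z) a (v + w) := by
  refine ⟨hf.1.add hg.1, (hf.2.add hg.2).congr' ?_⟩
  filter_upwards [MeromorphicAt.eventually_circleIntegrable (MeromorphicAt.div_sub_center hf.1),
    MeromorphicAt.eventually_circleIntegrable (MeromorphicAt.div_sub_center hg.1)] with ρ h1 h2
  simp_rw [add_div]
  rw [circleIntegral.integral_add h1 h2, mul_add]

/-- Cauchy's integral formula at the centre of the circle. -/
theorem Differentiable.hasPV {f : ℂ → ℂ} (hf : Differentiable ℂ f) (a : ℂ) :
    HasPV f a (f a) := by
  refine ⟨(hf.analyticAt a).meromorphicAt, tendsto_const_nhds.congr' ?_⟩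
  filter_upwards [self_mem_nhdsWithin] with ρ hρ
  have h := Complex.circleIntegral_div_sub_of_differentiable_on_off_countable (s := ∅) (c := a)
    (w := a) (R := ρ) countable_empty (Metric.mem_ball_self hρ) hf.continuous.continuousOn
    (fun z _ => hf z)
  rw [h, inv_mul_cancel_left₀ Complex.two_pi_I_ne_zero]

theorem eventually_nhdsNE_ne_intCast (m : ℤ) :
    ∀ᶠ z : ℂ in 𝓝[≠] (m : ℂ), ∀ k : ℤ, z ≠ k := by
  rw [eventually_nhdsWithin_iff, Metric.eventually_nhds_iff]
  refine ⟨1, one_pos, fun z hz hne k hk => hne ?_⟩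
  rw [hk, dist_eq_norm, ← Int.cast_sub, Complex.norm_intCast] at hz
  have h : |k - m| < 1 := by exact_mod_cast hz
  rw [hk, mem_singleton_iff, sub_eq_zero.1 (Int.abs_lt_one_iff.1 h)]

theorem meromorphicAt_gammaProduct (a : ℂ) : MeromorphicAt gammaProduct a := by
  have h1 : MeromorphicAt (fun z => Complex.Gamma (z + 2)) a :=
    (Meromorphic.Gamma (a + 2)).comp_analyticAt (g := fun z => z + 2) (by fun_prop)
  have h2 : Differentiable ℂ fun z => upperGamma (-z - 1) 1 :=
    differentiable_upperGamma.comp (differentiable_id.neg.sub_const 1)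
  exact ((MeromorphicAt.const _ a).mul h1).mul (h2.analyticAt a).meromorphicAt

theorem meromorphicAt_div_sin_pi_mul (c a : ℂ) :
    MeromorphicAt (fun z => -(c / Complex.sin ((Real.pi : ℂ) * z))) a := by
  have h : Differentiable ℂ fun z => Complex.sin ((Real.pi : ℂ) * z) := by fun_prop
  exact ((MeromorphicAt.const c a).div (h.analyticAt a).meromorphicAt).neg

end AltKurepa

theorem mainTheorem4 :
    (∀ z : ℂ, (∀ n : ℕ, 2 ≤ n → z ≠ -(n : ℂ)) →
      AltKurepa.A z =
        -(1 + (Real.exp 1 : ℂ) * (AltKurepa.Ei (-1) : ℂ)) * (-1 : ℂ) ^ z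
          + (Real.exp 1 : ℂ) * Complex.Gamma (z + 2) * AltKurepa.upperGamma (-z - 1) 1) ∧
    (∀ z : ℂ, (∀ m : ℤ, z ≠ (m : ℂ)) →
      AltKurepa.A₁ z =
        -((Real.pi : ℂ) * (Real.exp 1 : ℂ) / Complex.sin ((Real.pi : ℂ) * z))
          + (Real.exp 1 : ℂ) * Complex.Gamma (z + 2) * AltKurepa.upperGamma (-z - 1) 1) ∧
    (∀ m : ℤ, ∃ p q : ℂ,
      AltKurepa.HasPV
        (fun z => (Real.exp 1 : ℂ) * Complex.Gamma (z + 2) * AltKurepa.upperGamma (-z - 1) 1)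
        (m : ℂ) p ∧
      AltKurepa.HasPV
        (fun z => -((Real.pi : ℂ) * (Real.exp 1 : ℂ) / Complex.sin ((Real.pi : ℂ) * z)))
        (m : ℂ) q ∧
      AltKurepa.HasPV AltKurepa.A (m : ℂ)
        (-(1 + (Real.exp 1 : ℂ) * (AltKurepa.Ei (-1) : ℂ)) * (-1 : ℂ) ^ (m : ℂ) + p) ∧
      AltKurepa.HasPV AltKurepa.A₁ (m : ℂ) (q + p)) := by
  refine ⟨fun z hz => AltKurepa.A_eq_closedForm hz, fun z hz => AltKurepa.A₁_eq_closedForm₁ hz,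
    fun m => ?_⟩
  obtain ⟨p, hp⟩ :=
    AltKurepa.MeromorphicAt.exists_hasPV (AltKurepa.meromorphicAt_gammaProduct (m : ℂ))
  obtain ⟨q, hq⟩ := AltKurepa.MeromorphicAt.exists_hasPV
    (AltKurepa.meromorphicAt_div_sin_pi_mul ((Real.pi : ℂ) * (Real.exp 1 : ℂ)) (m : ℂ))
  have hd : Differentiable ℂ fun z : ℂ =>
      -(1 + (Real.exp 1 : ℂ) * (AltKurepa.Ei (-1) : ℂ)) * (-1 : ℂ) ^ z := fun z =>
    (differentiableAt_id.const_cpow (Or.inl (by norm_num))).const_mul _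
  refine ⟨p, q, hp, hq, ((AltKurepa.Differentiable.hasPV hd m).add hp).congr ?_,
    (hq.add hp).congr ?_⟩
  -- All exceptional points are integers, so a punctured neighbourhood of m avoids them, even when m
  -- is itself a pole.
  · filter_upwards [AltKurepa.eventually_nhdsNE_ne_intCast m] with z hz
    exact (AltKurepa.A_eq_closedForm fun k _ => by simpa using hz (-k)).symm
  · filter_upwards [AltKurepa.eventually_nhdsNE_ne_intCast m] with z hz
    exact (AltKurepa.A₁_eq_closedForm₁ hz).symm
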